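/- Let $\mathbb F_q$ be a finite field of characteristic $p$, let $m\ge 1$ with $\gcd(m,q)=1$, and let $C\le\mathbb F_q^n$ be an almost quasi-cyclic code: $C$ is a linear code invariant under a permutation $\sigma$ of the $n$ coordinates of type $m$-$(c,f)$, i.e. with $c$ cycles $\Omega_1,\dots,\Omega_c$ of length $m$ and $f$ fixed points $\Omega_{c+1},\dots,\Omega_{c+f}$, $n=cm+f$ (each cycle is listed as $\Omega_j=(i_{j,0},i_{j,1},\dots,i_{j,m-1})$ with $\sigma(i_{j,k})=i_{j,k+1}$, indices $k$ modulo $m$). Notation. $F_\sigma(C)$ is the subcode of the $v\in C$ fixed by $\sigma$; $E_\sigma(C)$ is the subcode of the $v\in C$ with $\sum_{i\in\Omega_j}v_i=0$ for all $j=1,\dots,c+f$; $C_\pi\subseteq\mathbb F_q^{c+f}$ is the image of $F_\sigma(C)$ under reading off one coordinate in every cycle; $E_\sigma(C)^*$ is $E_\sigma(C)$ with the $f$ fixed coordinates deleted. Let $\mathcal R_m=\mathbb F_q[x]/(x^m-1)$, let $\overline{v(x)}=v(x^{-1})=v(x^{m-1})$, and let $\phi:\mathbb F_q^{cm}\to\mathcal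 R_m^c$ send $v$ to the vector with entries $v_{j,0}+v_{j,1}x+\dots+v_{j,m-1}x^{m-1}$, where $v_{j,k}$ is the coordinate of $v$ at $i_{j,k}$. Factor $$x^m-1=\delta\,(x-1)\,g_1\cdots g_r\,h_1h_1^*\cdots h_th_t^*$$ into irreducibles, with $\delta\in\mathbb F_q^*$, each $g_i$ associated with its reciprocal polynomial, and $h^*$ denoting the reciprocal polynomial $x^{\deg h}h(1/x)$ of $h$. Let $G_i,H_j',H_j''$ be the ideals of $\mathcal R_m$ generated by $\frac{x^m-1}{g_i}$, $\frac{x^m-1}{h_j}$, $\frac{x^m-1}{h_j^*}$ (they are fields), and let $C_i,C_j',C_j''$ be the constituents of $\phi(E_\sigma(C)^*)$, that is, its intersections with $G_i^c$, $H_j'^c$, $H_j''^c$. Consider the condition (*) every $C_i$ ($1\le i\le r$) is Hermitian self-orthogonal, i.e. $\sum_k u_k\overline{v_k}=0$ for all $u,v\in C_i$, and $C_j''\subseteq(C_j')^\perp$ for all $1\le j\le t$ with respect to the Euclidean inner product over the field $H_j'$, where $H_j''$ is identified with $H_j'$ by $v\mapsto\overline v$; i.e. $\sum_k u_k\overline{v_k}=0$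 for all $u\in C_j'$, $v\in C_j''$. Then: (a) $C$ is Euclidean self-orthogonal if and only if $F_\sigma(C)$ is Euclidean self-orthogonal and (*) holds. (b) If moreover all cycles of $\sigma$ have lengths congruent modulo $p$, that is, $m\equiv1\pmod p$ or $f=0$, then $C$ is Euclidean self-orthogonal if and only if $C_\pi$ is Euclidean self-orthogonal and (*) holds. -/

import Mathlib

open Polynomial

noncomputable section

namespace AQC

/-! ### Codes, duals and permutation automorphisms -/

section Codes

variable {F : Type*} [Field F]

/-- The Euclidean dual `D^⊥ = {u | ∑ i, u i * v i = 0 for all v ∈ D}` of a code `D` of length `ι` over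
a commutative `F`-algebra `A` (for `A = F` this is the usual dual of a linear code over `F`). -/
def euclDual {A ι : Type*} [CommRing A] [Algebra F A] [Fintype ι] (D : Submodule F (ι → A)) :
    Submodule F (ι → A) where
  carrier := {u | ∀ v ∈ D, ∑ i, u i * v i = 0}
  add_mem' := by
    intro a b ha hb v hv
    simp [add_mul, Finset.sum_add_distrib, ha v hv, hb v hv]
  zero_mem' := by
    intro v _
    simp
  smul_mem' := by
    intro x a ha v hv
    have h := ha v hv
    simp [← Finset.smul_sum, h]

/-- A code is Euclidean self-orthogonal if it is contained in its Euclidean dual. -/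
def IsEuclSelfOrthogonal {A ι : Type*} [CommRing A] [Algebra F A] [Fintype ι]
    (D : Submodule F (ι → A)) : Prop :=
  D ≤ euclDual D

/-- `σ` is a permutation automorphism of `C`: permuting the coordinates by `σ` maps `C` onto `C`. -/
def IsPermAutomorphism {n : ℕ} (σ : Equiv.Perm (Fin n)) (C : Submodule F (Fin n → F)) : Prop :=
  C.map (LinearMap.funLeft F F σ) = C

/-- A permutation of type `m-(c,f)`, with its cycles listed: `pos (inl (j, k))` is the `k`-th point of
the `j`-th cycle of length `m`, and `pos (inr j)` is the `j`-th fixed point. -/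
structure CycleLabelling {n : ℕ} (σ : Equiv.Perm (Fin n)) (m c f : ℕ) where
  pos : (Fin c × ZMod m) ⊕ Fin f ≃ Fin n
  apply_cycle : ∀ j k, σ (pos (Sum.inl (j, k))) = pos (Sum.inl (j, k + 1))
  apply_fixed : ∀ j, σ (pos (Sum.inr j)) = pos (Sum.inr j)

variable {n m c f : ℕ}

/-- The fixed subcode `F_σ(C)`. -/
def fixedSubcode (σ : Equiv.Perm (Fin n)) (C : Submodule F (Fin n → F)) :
    Submodule F (Fin n → F) where
  carrier := {v | v ∈ C ∧ ∀ i, v (σ i) = v i}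
  add_mem' := by
    rintro a b ⟨ha, ha'⟩ ⟨hb, hb'⟩
    exact ⟨C.add_mem ha hb, fun i => by simp [ha', hb']⟩
  zero_mem' := ⟨C.zero_mem, fun i => rfl⟩
  smul_mem' := by
    rintro x a ⟨ha, ha'⟩
    exact ⟨C.smul_mem x ha, fun i => by simp [ha']⟩

/-- The subcode `E_σ(C)` of the codewords whose coordinates sum to zero over every cycle of `σ`
(the fixed points are cycles of length one). -/
def zeroSumSubcode [NeZero m] {σ : Equiv.Perm (Fin n)} (L : CycleLabelling σ m c f)
    (C : Submodule F (Fin n → F)) : Submodule F (Fin n → F) where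
  carrier := {v | v ∈ C ∧ (∀ j, ∑ k : ZMod m, v (L.pos (Sum.inl (j, k))) = 0) ∧
    ∀ j, v (L.pos (Sum.inr j)) = 0}
  add_mem' := by
    rintro a b ⟨ha, ha', ha''⟩ ⟨hb, hb', hb''⟩
    exact ⟨C.add_mem ha hb, fun j => by simp [Finset.sum_add_distrib, ha', hb'],
      fun j => by simp [ha'', hb'']⟩
  zero_mem' := ⟨C.zero_mem, fun j => by simp, fun j => rfl⟩
  smul_mem' := by
    rintro x a ⟨ha, ha', ha''⟩
    exact ⟨C.smul_mem x ha, fun j => by simp [← Finset.mul_sum, ha'], fun j => by simp [ha'']⟩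

/-- Reading off one coordinate on each of the `c + f` cycles of `σ`. On vectors that are fixed by `σ`
the chosen representatives do not matter. -/
def cycleProj {σ : Equiv.Perm (Fin n)} (L : CycleLabelling σ m c f) :
    (Fin n → F) →ₗ[F] (Fin c ⊕ Fin f → F) :=
  LinearMap.funLeft F F
    (Sum.elim (fun j => L.pos (Sum.inl (j, 0))) (fun j => L.pos (Sum.inr j)))

/-- The code `C_π = π(F_σ(C))` of length `c + f`. -/
def projCode {σ : Equiv.Perm (Fin n)} (L : CycleLabelling σ m c f)
    (C : Submodule F (Fin n → F)) : Submodule F (Fin c ⊕ Fin f → F) :=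
  (fixedSubcode σ C).map (cycleProj L)

/-- The code `E_σ(C)^*` of length `c * m`: delete the `f` fixed coordinates from `E_σ(C)`. -/
def zeroSumStar [NeZero m] {σ : Equiv.Perm (Fin n)} (L : CycleLabelling σ m c f)
    (C : Submodule F (Fin n → F)) : Submodule F (Fin c × ZMod m → F) :=
  (zeroSumSubcode L C).map (LinearMap.funLeft F F (fun jk => L.pos (Sum.inl jk)))

end Codes

/-! ### The ring `R_m = F[x]/(x^m - 1)` -/

section Ring

variable (F : Type*) [Field F] (m : ℕ)

/-- `R_m = F[x]/(x^m - 1)`. -/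
abbrev CyclicRing : Type _ := AdjoinRoot (X ^ m - 1 : F[X])

lemma root_pow : (AdjoinRoot.root (X ^ m - 1 : F[X])) ^ m = 1 := by
  have h := AdjoinRoot.eval₂_root (X ^ m - 1 : F[X])
  simpa [sub_eq_zero] using h

/-- The conjugation `v(x) ↦ v(x⁻¹) = v(x^(m-1))` of `R_m`. -/
def conj : CyclicRing F m →ₐ[F] CyclicRing F m :=
  AdjoinRoot.liftAlgHom (X ^ m - 1 : F[X]) (Algebra.ofId F (CyclicRing F m))
    (AdjoinRoot.root (X ^ m - 1 : F[X]) ^ (m - 1)) (by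
      have h : (AdjoinRoot.root (X ^ m - 1 : F[X]) ^ (m - 1)) ^ m = 1 := by
        rw [pow_right_comm, root_pow, one_pow]
      simp [h])

variable {F m}

/-- For a divisor `g` of `x^m - 1`, the ideal of `R_m` generated by `(x^m - 1)/g`. For `g` irreducible
and `m` prime to the characteristic it is a minimal ideal, and a field isomorphic to `F[x]/(g)`. -/
def componentIdeal (g : F[X]) : Ideal (CyclicRing F m) :=
  Ideal.span {AdjoinRoot.mk (X ^ m - 1) ((X ^ m - 1) / g)}

/-- Coordinatewise conjugation. -/
def conjVec (c : ℕ) : (Fin c → CyclicRing F m) →ₗ[F] (Fin c → CyclicRing F m) :=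
  (conj F m).toLinearMap.compLeft (Fin c)

/-- A code over `R_m` is Hermitian self-orthogonal if `∑ i, u i * conj (v i) = 0` for all `u`, `v` in
it. -/
def IsHermSelfOrthogonal {c : ℕ} (D : Submodule F (Fin c → CyclicRing F m)) : Prop :=
  ∀ u ∈ D, ∀ v ∈ D, ∑ i, u i * conj F m (v i) = 0

/-- The map `φ : F^(cm) → R_m^c`, `φ(v)_j = v_(j,0) + v_(j,1) x + ⋯ + v_(j,m-1) x^(m-1)`. -/
def phi (c : ℕ) [NeZero m] : (Fin c × ZMod m → F) →ₗ[F] (Fin c → CyclicRing F m) :=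
  LinearMap.pi fun j => ∑ k : ZMod m,
    (LinearMap.proj (j, k)).smulRight (AdjoinRoot.root (X ^ m - 1 : F[X]) ^ k.val)

/-- The constituent, at the irreducible factor `g` of `x^m - 1`, of a code `D` over `R_m`: the summand
`D ∩ G^c` of `D`, where `G` is the minimal ideal of `R_m` that belongs to `g`. -/
def constituent {c : ℕ} (D : Submodule F (Fin c → CyclicRing F m)) (g : F[X]) :
    Submodule F (Fin c → CyclicRing F m) :=
  D ⊓ Submodule.pi Set.univ fun _ => (componentIdeal (m := m) g).restrictScalars F

/-- A factorization `x^m - 1 = δ (x - 1) g_1 ⋯ g_r h_1 h_1^* ⋯ h_t h_t^*` into irreducible factors,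
where each `g_i` is associated with its reciprocal polynomial, and `h^*` is the reciprocal polynomial
`x^(deg h) h(1/x)` of `h`. -/
structure ReciprocalFactorization (F : Type*) [Field F] (m r t : ℕ) where
  δ : F
  g : Fin r → F[X]
  h : Fin t → F[X]
  δ_ne_zero : δ ≠ 0
  irreducible_g : ∀ i, Irreducible (g i)
  associated_reverse_g : ∀ i, Associated (g i) (g i).reverse
  irreducible_h : ∀ j, Irreducible (h j)
  factorization : (X ^ m - 1 : F[X]) =
    C δ * (X - 1) * (∏ i, g i) * ∏ j, (h j * (h j).reverse)

lemma reverse_reverse_of_coeff_ne_zero {F : Type*} [Field F] {P : F[X]} (h : P.coeff 0 ≠ 0) :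
    P.reverse.reverse = P := by
  have hd : P.reverse.natDegree = P.natDegree := by
    rw [reverse_natDegree, natTrailingDegree_eq_zero.2 (Or.inr h), Nat.sub_zero]
  rw [reverse, hd, reverse, reflect_reflect]

lemma irreducible_reverse {F : Type*} [Field F] {a : F[X]} (ha : Irreducible a)
    (h0 : a.coeff 0 ≠ 0) : Irreducible a.reverse := by
  have hdeg : ∀ b : F[X], b.coeff 0 ≠ 0 → b.reverse.natDegree = b.natDegree := by
    intro b hb
    rw [reverse_natDegree, natTrailingDegree_eq_zero.2 (Or.inr hb), Nat.sub_zero]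
  have hunit : ∀ b : F[X], b.coeff 0 ≠ 0 → IsUnit b.reverse → IsUnit b := by
    intro b hb hu
    have hd : b.natDegree = 0 := by rw [← hdeg b hb, natDegree_eq_zero_of_isUnit hu]
    rw [eq_C_of_natDegree_eq_zero hd]
    exact isUnit_C.2 (isUnit_iff_ne_zero.2 hb)
  refine ⟨fun hu => ?_, fun b c hbc => ?_⟩
  · have h1 := natDegree_eq_zero_of_isUnit hu
    rw [hdeg a h0] at h1
    exact ha.natDegree_pos.ne' h1
  · have hc : b.coeff 0 * c.coeff 0 ≠ 0 := by
      rw [← mul_coeff_zero, ← hbc, coeff_zero_reverse]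
      exact leadingCoeff_ne_zero.2 ha.ne_zero
    have hmul : a = b.reverse * c.reverse := by
      rw [← reverse_mul_of_domain, ← hbc, reverse_reverse_of_coeff_ne_zero h0]
    exact (ha.isUnit_or_isUnit hmul).imp (hunit b (left_ne_zero_of_mul hc))
      (hunit c (right_ne_zero_of_mul hc))

lemma exists_reciprocal_lists {F : Type*} [Field F] (N : ℕ) : ∀ P : F[X], P.natDegree ≤ N →
    P.coeff 0 ≠ 0 → Associated P P.reverse → ∃ G H : List F[X],
      (∀ g ∈ G, Irreducible g ∧ Associated g g.reverse) ∧ (∀ h ∈ H, Irreducible h) ∧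
      Associated P (G.prod * (H.map fun h => h * h.reverse).prod) := by
  induction N using Nat.strong_induction_on with
  | _ N ih =>
  intro P hN h0 hP
  have hP0 : P ≠ 0 := by
    rintro rfl
    simp at h0
  by_cases hu : IsUnit P
  · exact ⟨[], [], by simp, by simp, by simpa using (associated_one_iff_isUnit.2 hu)⟩
  obtain ⟨a, ha, haP⟩ := WfDvdMonoid.exists_irreducible_factor hu hP0
  have hcoeff : ∀ b Q : F[X], P = b * Q → b.coeff 0 ≠ 0 ∧ Q.coeff 0 ≠ 0 := by
    intro b Q hbQ
    rw [hbQ, mul_coeff_zero] at h0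
    exact mul_ne_zero_iff.1 h0
  have hpos : 0 < a.natDegree := ha.natDegree_pos
  have step : ∀ b : F[X], b ∣ P → 0 < b.natDegree → Associated b b.reverse →
      ∃ Q, P = b * Q ∧ ∃ G H : List F[X],
      (∀ g ∈ G, Irreducible g ∧ Associated g g.reverse) ∧ (∀ h ∈ H, Irreducible h) ∧
      Associated Q (G.prod * (H.map fun h => h * h.reverse).prod) := by
    rintro b ⟨Q, hQ⟩ hb hbr
    obtain ⟨hb0, hQ0⟩ := hcoeff b Q hQ
    have hbne : b ≠ 0 := by
      rintro rfl
      simp at hb0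
    have hQne : Q ≠ 0 := by
      rintro rfl
      simp at hQ0
    have hdeg : P.natDegree = b.natDegree + Q.natDegree := by rw [hQ, natDegree_mul hbne hQne]
    refine ⟨Q, hQ, ih Q.natDegree (by omega) Q le_rfl hQ0 ?_⟩
    rw [hQ, reverse_mul_of_domain] at hP
    exact Associated.of_mul_left hP hbr hbne
  have ha0 : a.coeff 0 ≠ 0 := by
    obtain ⟨Q, hQ⟩ := haP
    exact (hcoeff a Q hQ).1
  by_cases har : Associated a a.reverse
  · obtain ⟨Q, hQ, G, H, hG, hH, hA⟩ := step a haP hpos har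
    refine ⟨a :: G, H, ?_, hH, ?_⟩
    · intro g hg
      rcases List.mem_cons.1 hg with rfl | hg
      · exact ⟨ha, har⟩
      · exact hG g hg
    · rw [hQ, List.prod_cons, mul_assoc]
      exact hA.mul_left a
  · have hrirr : Irreducible a.reverse := irreducible_reverse ha ha0
    have hrP : a.reverse ∣ P := by
      obtain ⟨Q, hQ⟩ := haP
      refine dvd_trans ?_ hP.symm.dvd
      rw [hQ, reverse_mul_of_domain]
      exact dvd_mul_right _ _
    have hcop : IsCoprime a a.reverse :=
      ha.coprime_iff_not_dvd.2 fun hd => har (ha.associated_of_dvd hrirr hd)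
    have hmul : a * a.reverse ∣ P := hcop.mul_dvd haP hrP
    have hdeg : 0 < (a * a.reverse).natDegree := by
      rw [natDegree_mul ha.ne_zero hrirr.ne_zero]
      omega
    obtain ⟨Q, hQ, G, H, hG, hH, hA⟩ := step _ hmul hdeg (by
      rw [reverse_mul_of_domain, reverse_reverse_of_coeff_ne_zero ha0, mul_comm])
    refine ⟨G, a :: H, hG, ?_, ?_⟩
    · intro g hg
      rcases List.mem_cons.1 hg with rfl | hg
      · exact ha
      · exact hH g hg
    · rw [hQ, List.map_cons, List.prod_cons, mul_left_comm]
      exact hA.mul_left _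

/-- Such a factorization always exists. -/
theorem exists_reciprocalFactorization (F : Type*) [Field F] (m : ℕ) [NeZero m] :
    ∃ r t, Nonempty (ReciprocalFactorization F m r t) := by
  have hm : m ≠ 0 := NeZero.ne m
  have hrev : ∀ k : ℕ, k ≠ 0 → (X ^ k - 1 : F[X]).reverse = -(X ^ k - 1) := by
    intro k hk
    have hd : (X ^ k - 1 : F[X]).natDegree = k := by
      simpa using natDegree_X_pow_sub_C (n := k) (r := (1 : F))
    have h1 : reflect k (1 : F[X]) = X ^ k := by simp
    have h2 : reflect k (X ^ k : F[X]) = 1 := by rw [← h1, reflect_reflect]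
    rw [reverse, hd, reflect_sub, h1, h2, neg_sub]
  obtain ⟨Q, hQ⟩ : (X - 1 : F[X]) ∣ X ^ m - 1 := sub_one_dvd_pow_sub_one X m
  have hX1 : (X - 1 : F[X]) ≠ 0 := by simpa using X_sub_C_ne_zero (1 : F)
  have hQ0 : Q.coeff 0 ≠ 0 := by
    intro h
    have := congrArg (fun P => coeff P 0) hQ
    simp [mul_coeff_zero, h, hm.symm] at this
  have hQr : Associated Q Q.reverse := by
    have h := hrev m hm
    have h1 := hrev 1 one_ne_zero
    rw [pow_one] at h1
    rw [hQ, reverse_mul_of_domain, h1, neg_mul, neg_inj] at h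
    rw [mul_left_cancel₀ hX1 h]
  obtain ⟨G, H, hG, hH, hA⟩ := exists_reciprocal_lists _ Q le_rfl hQ0 hQr
  obtain ⟨u, hu⟩ := hA.symm
  obtain ⟨d, hd, hdu⟩ := Polynomial.isUnit_iff.1 u.isUnit
  refine ⟨G.length, H.length, ⟨⟨d, G.get, H.get, hd.ne_zero, fun i => (hG _ (G.get_mem i)).1,
    fun i => (hG _ (G.get_mem i)).2, fun j => hH _ (H.get_mem j), ?_⟩⟩⟩
  have e1 : ∏ i, G.get i = G.prod := by rw [← List.prod_ofFn, List.ofFn_get]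
  have e2 : ∏ j, (H.get j * (H.get j).reverse) = (H.map fun h => h * h.reverse).prod := by
    rw [← List.prod_ofFn]
    congr 1
    conv_rhs => rw [← List.ofFn_get H, List.map_ofFn]
    rfl
  rw [e1, e2, hQ, ← hu, hdu]
  ring

end Ring

section Constituents

variable {F : Type*} [Field F] {n m c f : ℕ} [NeZero m]

/-- The code `C_φ = φ(E_σ(C)^*)` over `R_m`. -/
def phiCode {σ : Equiv.Perm (Fin n)} (L : CycleLabelling σ m c f)
    (C : Submodule F (Fin n → F)) : Submodule F (Fin c → CyclicRing F m) :=
  (zeroSumStar L C).map (phi c)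

/-- The conditions on the constituents `C_i`, `C'_j`, `C''_j` of `E_σ(C)^*`: every `C_i` is Hermitian
self-orthogonal, and `C''_j ⊆ (C'_j)^⊥` for the Euclidean inner product over the field `H'_j`, where
the field `H''_j` is identified with `H'_j` by the isomorphism `v(x) ↦ v(x⁻¹)`. -/
def ConstituentsOrthogonal {σ : Equiv.Perm (Fin n)} (L : CycleLabelling σ m c f)
    (C : Submodule F (Fin n → F)) {r t : ℕ} (Φ : ReciprocalFactorization F m r t) : Prop :=
  (∀ i, IsHermSelfOrthogonal (constituent (phiCode L C) (Φ.g i))) ∧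
  ∀ j, (constituent (phiCode L C) (Φ.h j).reverse).map (conjVec c) ≤
    euclDual (constituent (phiCode L C) (Φ.h j))

end Constituents

end AQC

end

/-! Since `m` is prime to `q`, it is invertible in `F`, and averaging over the powers of `σ` splits
every codeword into a `σ`-fixed part and a part with zero sum on every cycle
(`exists_fixed_add_zeroSum`). The two subcodes are orthogonal to each other, because a fixed vector
is constant on cycles. So `C` is self-orthogonal iff both subcodes are
(`isEuclSelfOrthogonal_iff_fixed_and_zeroSum`).

For the zero-sum part, the coefficients of the Hermitian form on `R_m^c` are the inner products with
all cyclic shifts (`hermForm_cyclicVec`). As the subcode is `σ`-invariant, it is self-orthogonal iff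
the form vanishes on its image. Let `W` be a polynomial representing a value of the form. Since `x^m
- 1` is squarefree, `W` vanishes in `R_m` as soon as every irreducible factor of `x^m - 1` divides
it. The factor `x - 1` does so by the zero-sum condition. The other factors are handled by
multiplying codewords into constituents (`dvd_of_constituents_orthogonal`), so `R_m` need not be
decomposed into fields.

For (b), the inner product of two fixed vectors weights each long cycle by `m` and each fixed point
by `1`. When `m = 1` in `F` or `f = 0`, this is `m` times the inner product of the projections. -/

noncomputable section

namespace AQC

/-! ### Squarefree divisibility and the reciprocal of `x^m - 1`. -/

section PolynomialFacts

variable {F : Type*} [Field F]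

/-- Write `N = gcd(N, W) * e`. An irreducible factor of `e` would divide `W`, hence also the gcd,
and its square would divide `N`. -/
lemma dvd_of_squarefree_of_irreducible_dvd {N W : F[X]} (hN : Squarefree N)
    (h : ∀ q, Irreducible q → q ∣ N → q ∣ W) : N ∣ W := by
  classical
  obtain ⟨e, he⟩ := EuclideanDomain.gcd_dvd_left N W
  have hN0 : N ≠ 0 := hN.ne_zero
  have he0 : e ≠ 0 := by
    rintro rfl
    exact hN0 (by simpa using he)
  by_cases hu : IsUnit e
  · obtain ⟨u, rfl⟩ := hu
    have hd : N ∣ EuclideanDomain.gcd N W := ⟨((u⁻¹ : F[X]ˣ) : F[X]), by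
      conv_rhs => rw [he]
      rw [mul_assoc, Units.mul_inv, mul_one]⟩
    exact hd.trans (EuclideanDomain.gcd_dvd_right N W)
  · obtain ⟨q, hq, hqe⟩ := WfDvdMonoid.exists_irreducible_factor hu he0
    have hqN : q ∣ N := hqe.trans ⟨_, by rw [mul_comm]; exact he⟩
    have hqd : q ∣ EuclideanDomain.gcd N W := EuclideanDomain.dvd_gcd hqN (h q hq hqN)
    exact absurd (hN q (by rw [he]; exact mul_dvd_mul hqd hqe)) hq.not_isUnit

lemma reverse_X_pow_sub_one (m : ℕ) [NeZero m] :
    (X ^ m - 1 : F[X]).reverse = -(X ^ m - 1) := by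
  have hd : (X ^ m - 1 : F[X]).natDegree = m := by
    simpa using natDegree_X_pow_sub_C (n := m) (r := (1 : F))
  have h1 : reflect m (1 : F[X]) = X ^ m := by simp
  have h2 : reflect m (X ^ m : F[X]) = 1 := by rw [← h1, reflect_reflect]
  rw [reverse, hd, reflect_sub, h1, h2, neg_sub]

end PolynomialFacts

/-! ### Conjugation, the Hermitian form and constituents over `R_m`. -/

section CyclicRing

variable {F : Type*} [Field F] {m : ℕ}

lemma conj_root : conj F m (AdjoinRoot.root _) = AdjoinRoot.root (X ^ m - 1 : F[X]) ^ (m - 1) := by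
  simp [conj]

lemma conj_root_mul_root [NeZero m] :
    conj F m (AdjoinRoot.root _) * AdjoinRoot.root (X ^ m - 1 : F[X]) = 1 := by
  rw [conj_root, ← pow_succ, Nat.sub_add_cancel (NeZero.pos m), root_pow]

lemma conj_conj [NeZero m] (w : CyclicRing F m) : conj F m (conj F m w) = w := by
  have h : (conj F m).comp (conj F m) = AlgHom.id F (CyclicRing F m) := by
    refine AdjoinRoot.algHom_ext ?_
    have h1 := congrArg (conj F m) (conj_root_mul_root (F := F) (m := m))
    rw [map_mul, map_one] at h1
    have h2 := conj_root_mul_root (F := F) (m := m)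
    simp only [AlgHom.comp_apply, AlgHom.id_apply]
    calc _ = conj F m (conj F m (AdjoinRoot.root _)) *
          (conj F m (AdjoinRoot.root _) * AdjoinRoot.root (X ^ m - 1 : F[X])) := by rw [h2, mul_one]
      _ = _ := by rw [← mul_assoc, h1, one_mul]
  exact DFunLike.congr_fun h w

/-- Conjugation is evaluation at `x⁻¹`, so up to the unit `x^(deg A)` it is passage to the
reciprocal polynomial. -/
lemma conj_mk_mul_root_pow [NeZero m] (A : F[X]) :
    conj F m (AdjoinRoot.mk _ A) * AdjoinRoot.root (X ^ m - 1 : F[X]) ^ A.natDegree =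
      AdjoinRoot.mk _ A.reverse := by
  have h1 : ∀ B : F[X], eval₂ (algebraMap F (CyclicRing F m)) (AdjoinRoot.root _) B =
      AdjoinRoot.mk _ B := fun B => by
    rw [← aeval_def, AdjoinRoot.aeval_eq]
  have h3 : conj F m (AdjoinRoot.mk _ A) =
      eval₂ (algebraMap F (CyclicRing F m)) (conj F m (AdjoinRoot.root _)) A := by
    rw [← AdjoinRoot.aeval_eq, ← aeval_def, aeval_algHom_apply]
  have h2 : eval₂ (algebraMap F (CyclicRing F m)) (AdjoinRoot.root _) A.reverse *
      conj F m (AdjoinRoot.root _) ^ A.natDegree =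
      eval₂ (algebraMap F (CyclicRing F m)) (conj F m (AdjoinRoot.root _)) A := by
    let _ : Invertible (conj F m (AdjoinRoot.root (X ^ m - 1 : F[X]))) :=
      ⟨AdjoinRoot.root _, by rw [mul_comm]; exact conj_root_mul_root, conj_root_mul_root⟩
    exact eval₂_reverse_mul_pow (algebraMap F (CyclicRing F m))
      (conj F m (AdjoinRoot.root _)) A
  rw [h3, ← h2, mul_assoc, ← mul_pow, conj_root_mul_root, one_pow, mul_one, h1]

/-- The power `x ^ k` in `R_m`, with the exponent modulo `m`. -/
def rootPow (k : ZMod m) : CyclicRing F m := AdjoinRoot.root (X ^ m - 1 : F[X]) ^ k.val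

lemma root_pow_mod (a : ℕ) : AdjoinRoot.root (X ^ m - 1 : F[X]) ^ (a % m) =
    AdjoinRoot.root (X ^ m - 1 : F[X]) ^ a := by
  conv_rhs => rw [← Nat.mod_add_div a m, pow_add, pow_mul, root_pow, one_pow, mul_one]

lemma rootPow_add [NeZero m] (k l : ZMod m) : rootPow (F := F) (k + l) = rootPow k * rootPow l := by
  rw [rootPow, ZMod.val_add, root_pow_mod, pow_add, rootPow, rootPow]

lemma rootPow_zero : rootPow (F := F) (0 : ZMod m) = 1 := by
  simp [rootPow]

lemma rootPow_one [NeZero m] : rootPow (F := F) (1 : ZMod m) = AdjoinRoot.root _ := by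
  rw [rootPow, ZMod.val_one_eq_one_mod, root_pow_mod, pow_one]

lemma conj_rootPow [NeZero m] (k : ZMod m) : conj F m (rootPow k) = rootPow (-k) := by
  have h1 : rootPow (F := F) (-k) * rootPow k = 1 := by
    rw [← rootPow_add, neg_add_cancel, rootPow_zero]
  have h2 : conj F m (rootPow k) * rootPow k = 1 := by
    rw [rootPow, map_pow, ← mul_pow, conj_root_mul_root, one_pow]
  calc conj F m (rootPow k) = conj F m (rootPow k) * (rootPow (-k) * rootPow k) := by
        rw [h1, mul_one]
    _ = (conj F m (rootPow k) * rootPow k) * rootPow (-k) := by ring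
    _ = rootPow (-k) := by rw [h2, one_mul]

/-- The powers `x^k` with `k < m` are independent: a multiple of `x^m - 1` of degree less than `m`
is zero. -/
lemma eq_zero_of_sum_smul_rootPow [NeZero m] (a : ZMod m → F)
    (h : ∑ k, a k • rootPow (F := F) k = 0) (k : ZMod m) : a k = 0 := by
  set W : F[X] := ∑ k : ZMod m, C (a k) * X ^ k.val with hW
  have hmk : AdjoinRoot.mk (X ^ m - 1 : F[X]) W = 0 := by
    rw [← h, hW, map_sum]
    refine Finset.sum_congr rfl fun k _ => ?_
    rw [map_mul, map_pow, AdjoinRoot.mk_X, AdjoinRoot.mk_C, rootPow, Algebra.smul_def]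
    rfl
  have hd : (X ^ m - 1 : F[X]).degree = m := by
    simpa using degree_X_pow_sub_C (NeZero.pos m) (1 : F)
  have hW0 : W = 0 := by
    refine eq_zero_of_dvd_of_degree_lt (AdjoinRoot.mk_eq_zero.1 hmk) ?_
    rw [hd, hW]
    refine (degree_sum_le _ _).trans_lt ?_
    rw [Finset.sup_lt_iff (by exact WithBot.bot_lt_coe m)]
    intro k _
    exact (degree_C_mul_X_pow_le _ _).trans_lt (by exact_mod_cast ZMod.val_lt k)
  have hc := congrArg (fun P => coeff P k.val) hW0
  simp only [hW, finsetSum_coeff, coeff_C_mul, coeff_X_pow, coeff_zero, mul_ite, mul_one,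
    mul_zero] at hc
  rw [Finset.sum_eq_single k] at hc
  · simpa using hc
  · intro l _ hl
    rw [if_neg]
    exact fun h => hl (ZMod.val_injective m h).symm
  · simp

/-- The Hermitian form `∑ i, u i * conj (v i)` on `R_m^c`. -/
def hermForm {c : ℕ} (u v : Fin c → CyclicRing F m) : CyclicRing F m :=
  ∑ i, u i * conj F m (v i)

lemma hermForm_smul_smul {c : ℕ} (a b : CyclicRing F m) (u v : Fin c → CyclicRing F m) :
    hermForm (fun i => a * u i) (fun i => b * v i) = a * conj F m b * hermForm u v := by
  rw [hermForm, hermForm, Finset.mul_sum]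
  refine Finset.sum_congr rfl fun i _ => ?_
  rw [map_mul]
  ring

lemma conj_hermForm [NeZero m] {c : ℕ} (u v : Fin c → CyclicRing F m) :
    conj F m (hermForm u v) = hermForm v u := by
  rw [hermForm, hermForm, map_sum]
  refine Finset.sum_congr rfl fun i _ => ?_
  rw [map_mul, conj_conj, mul_comm]

/-- Codes are only `F`-subspaces here; closure under multiplication by `x` makes them
`R_m`-submodules. -/
lemma mul_mem_of_root_mul_mem {c : ℕ} {D : Submodule F (Fin c → CyclicRing F m)}
    (hD : ∀ u ∈ D, (fun i => AdjoinRoot.root (X ^ m - 1 : F[X]) * u i) ∈ D)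
    (a : CyclicRing F m) {u : Fin c → CyclicRing F m} (hu : u ∈ D) :
    (fun i => a * u i) ∈ D := by
  obtain ⟨A, rfl⟩ := AdjoinRoot.mk_surjective a
  induction A using Polynomial.induction_on' with
  | add P Q hP hQ =>
    simp only [map_add, add_mul]
    exact D.add_mem hP hQ
  | monomial k x =>
    rw [← C_mul_X_pow_eq_monomial]
    have hk : ∀ k : ℕ, (fun i => AdjoinRoot.root (X ^ m - 1 : F[X]) ^ k * u i) ∈ D := by
      intro k
      induction k with
      | zero => simpa using hu
      | succ k ih => simpa only [pow_succ', mul_assoc] using hD _ ih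
    have h := D.smul_mem x (hk k)
    convert h using 1
    ext i
    simp only [map_mul, map_pow, AdjoinRoot.mk_X, AdjoinRoot.mk_C, Pi.smul_apply,
      Algebra.smul_def, mul_assoc]
    rfl

lemma smul_mem_constituent {c : ℕ} {D : Submodule F (Fin c → CyclicRing F m)}
    (hD : ∀ u ∈ D, (fun i => AdjoinRoot.root (X ^ m - 1 : F[X]) * u i) ∈ D)
    (g : F[X]) {u : Fin c → CyclicRing F m} (hu : u ∈ D) :
    (fun i => AdjoinRoot.mk (X ^ m - 1 : F[X]) ((X ^ m - 1) / g) * u i) ∈ constituent D g := by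
  refine ⟨mul_mem_of_root_mul_mem hD _ hu, ?_⟩
  intro i _
  exact Ideal.mul_mem_right _ _ (Ideal.mem_span_singleton_self _)

/-- If the Hermitian form vanishes between the constituents at `k` and `l`, where `k` is associated
with the reciprocal of `l`, then its values on the whole code are divisible by `k`. -/
lemma dvd_of_constituents_orthogonal [NeZero m] (hN : Squarefree (X ^ m - 1 : F[X])) {c : ℕ}
    {D : Submodule F (Fin c → CyclicRing F m)}
    (hD : ∀ u ∈ D, (fun i => AdjoinRoot.root (X ^ m - 1 : F[X]) * u i) ∈ D)
    {k l : F[X]} (hk : Irreducible k) (hkN : k ∣ X ^ m - 1) (hlN : l ∣ X ^ m - 1)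
    (hkl : k ∣ l.reverse)
    (h : ∀ u ∈ constituent D k, ∀ v ∈ constituent D l, hermForm u v = 0)
    {u v : Fin c → CyclicRing F m} (hu : u ∈ D) (hv : v ∈ D) {W : F[X]}
    (hW : AdjoinRoot.mk _ W = hermForm u v) : k ∣ W := by
  have hk' : k * ((X ^ m - 1) / k) = X ^ m - 1 := EuclideanDomain.mul_div_cancel' hk.ne_zero hkN
  have hl0 : l ≠ 0 := by
    rintro rfl
    exact hN.ne_zero (zero_dvd_iff.1 hlN)
  have hl' : l * ((X ^ m - 1) / l) = X ^ m - 1 := EuclideanDomain.mul_div_cancel' hl0 hlN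
  set P := (X ^ m - 1) / k
  set Q := (X ^ m - 1) / l
  have h0 := h _ (smul_mem_constituent hD k hu) _ (smul_mem_constituent hD l hv)
  rw [hermForm_smul_smul, ← hW] at h0
  -- The unit `x^(deg Q)` turns the conjugate of `Q` into its reciprocal, giving a divisibility
  -- between polynomials.
  have h1 : AdjoinRoot.mk (X ^ m - 1 : F[X]) (P * Q.reverse * W) = 0 := by
    rw [map_mul, map_mul, ← conj_mk_mul_root_pow]
    linear_combination AdjoinRoot.root (X ^ m - 1 : F[X]) ^ Q.natDegree * h0
  have hdvd : k ∣ P * Q.reverse * W := hkN.trans (AdjoinRoot.mk_eq_zero.1 h1)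
  have hp := hk.prime
  rcases hp.dvd_or_dvd hdvd with h2 | h2
  -- If `k` divided `P` or `Q.reverse`, then `k * k` would divide `k * P = x^m - 1` or `l.reverse *
  -- Q.reverse = -(x^m - 1)`, against squarefreeness.
  · exfalso
    refine hk.not_isUnit (hN k ?_)
    rcases hp.dvd_or_dvd h2 with h3 | h3
    · rw [← hk']
      exact mul_dvd_mul_left k h3
    · have h4 : k * k ∣ -(X ^ m - 1) := by
        rw [← reverse_X_pow_sub_one, ← hl', reverse_mul_of_domain]
        exact mul_dvd_mul hkl h3
      exact (dvd_neg).1 h4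
  · exact h2

lemma constituent_le {c : ℕ} (D : Submodule F (Fin c → CyclicRing F m)) (g : F[X]) :
    constituent D g ≤ D := inf_le_left

/-- The augmentation `R_m → F`, `x ↦ 1`. -/
def augmentation : CyclicRing F m →ₐ[F] F :=
  AdjoinRoot.liftAlgHom (X ^ m - 1 : F[X]) (Algebra.ofId F F) 1 (by simp)

lemma augmentation_mk (W : F[X]) : augmentation (AdjoinRoot.mk (X ^ m - 1 : F[X]) W) =
    W.eval 1 := by
  rw [augmentation, AdjoinRoot.liftAlgHom_mk]
  rfl

/-- For a code over `R_m` that is closed under multiplication by `x` and has no component at `x - 1`,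
the Hermitian form vanishes as soon as it vanishes on the constituents. -/
lemma hermForm_eq_zero_iff [NeZero m] (hN : Squarefree (X ^ m - 1 : F[X])) {c r t : ℕ}
    (Φ : ReciprocalFactorization F m r t)
    {D : Submodule F (Fin c → CyclicRing F m)}
    (hD : ∀ u ∈ D, (fun i => AdjoinRoot.root (X ^ m - 1 : F[X]) * u i) ∈ D)
    (hD1 : ∀ u ∈ D, ∀ i, augmentation (u i) = 0) :
    (∀ u ∈ D, ∀ v ∈ D, hermForm u v = 0) ↔
      (∀ i, IsHermSelfOrthogonal (constituent D (Φ.g i))) ∧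
      ∀ j, (constituent D (Φ.h j).reverse).map (conjVec c) ≤
        euclDual (constituent D (Φ.h j)) := by
  -- The Euclidean dual condition on the conjugated code is the vanishing of the Hermitian form
  -- between the two constituents.
  have hswap : ∀ j, (constituent D (Φ.h j).reverse).map (conjVec c) ≤
        euclDual (constituent D (Φ.h j)) ↔ ∀ u ∈ constituent D (Φ.h j),
        ∀ v ∈ constituent D (Φ.h j).reverse, hermForm u v = 0 := by
    intro j
    rw [Submodule.map_le_iff_le_comap]
    constructor
    · intro h u hu v hv
      have := h hv u hu
      rw [← this]
      exact Finset.sum_congr rfl fun i _ => mul_comm _ _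
    · intro h v hv u hu
      rw [← h u hu v hv]
      exact Finset.sum_congr rfl fun i _ => mul_comm _ _
  simp only [hswap]
  constructor
  · intro h
    exact ⟨fun i u hu v hv => h u (constituent_le _ _ hu) v (constituent_le _ _ hv),
      fun j u hu v hv => h u (constituent_le _ _ hu) v (constituent_le _ _ hv)⟩
  · rintro ⟨hg, hh⟩ u hu v hv
    obtain ⟨W, hW⟩ := AdjoinRoot.mk_surjective (hermForm u v)
    rw [← hW]
    refine AdjoinRoot.mk_eq_zero.2 (dvd_of_squarefree_of_irreducible_dvd hN fun q hq hqN => ?_)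
    have hgN : ∀ i, Φ.g i ∣ X ^ m - 1 := fun i => by
      rw [Φ.factorization]
      exact Dvd.dvd.mul_right (Dvd.dvd.mul_left (Finset.dvd_prod_of_mem _ (Finset.mem_univ i)) _) _
    have hhhN : ∀ j, Φ.h j * (Φ.h j).reverse ∣ X ^ m - 1 := fun j => by
      rw [Φ.factorization]
      exact Dvd.dvd.mul_left (Finset.dvd_prod_of_mem (fun j => Φ.h j * (Φ.h j).reverse)
        (Finset.mem_univ j)) _
    have hhN : ∀ j, Φ.h j ∣ X ^ m - 1 := fun j => (dvd_mul_right _ _).trans (hhhN j)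
    have hrN : ∀ j, (Φ.h j).reverse ∣ X ^ m - 1 := fun j => (dvd_mul_left _ _).trans (hhhN j)
    have hh0 : ∀ j, (Φ.h j).coeff 0 ≠ 0 := fun j h0 => by
      obtain ⟨R, hR⟩ := hhN j
      have := congrArg (fun P => coeff P 0) hR
      simp [mul_coeff_zero, h0, (NeZero.ne m).symm] at this
    have hp := hq.prime
    have hq' := hqN
    rw [Φ.factorization] at hq'
    rcases hp.dvd_or_dvd hq' with h1 | h1
    · rcases hp.dvd_or_dvd h1 with h2 | h2
      · rcases hp.dvd_or_dvd h2 with h3 | h3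
        · exact absurd (isUnit_of_dvd_unit h3 (isUnit_C.2 (isUnit_iff_ne_zero.2 Φ.δ_ne_zero)))
            hq.not_isUnit
        -- Divisibility by `x - 1` means that the augmentation of the form vanishes, which `hD1`
        -- gives.
        · refine h3.trans ?_
          have : (X - 1 : F[X]) = X - C 1 := by simp
          rw [this, dvd_iff_isRoot, IsRoot, ← augmentation_mk (m := m), hW, hermForm, map_sum]
          exact Finset.sum_eq_zero fun i _ => by rw [map_mul, hD1 u hu, zero_mul]
      · obtain ⟨i, -, hi⟩ := (Prime.dvd_finsetProd_iff hp _).1 h2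
        exact hi.trans (dvd_of_constituents_orthogonal hN hD (Φ.irreducible_g i) (hgN i) (hgN i)
          (Φ.associated_reverse_g i).dvd (hg i) hu hv hW)
    · obtain ⟨j, -, hj⟩ := (Prime.dvd_finsetProd_iff hp _).1 h1
      rcases hp.dvd_or_dvd hj with hj | hj
      · refine hj.trans (dvd_of_constituents_orthogonal hN hD (Φ.irreducible_h j) (hhN j) (hrN j)
          ?_ (hh j) hu hv hW)
        rw [reverse_reverse_of_coeff_ne_zero (hh0 j)]
      · refine hj.trans (dvd_of_constituents_orthogonal hN hD
          (irreducible_reverse (Φ.irreducible_h j) (hh0 j)) (hrN j) (hhN j) dvd_rfl ?_ hu hv hW)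
        -- At the reciprocal factor the two constituents trade places, which the conjugate symmetry
        -- of the form allows.
        intro x hx y hy
        rw [← conj_hermForm, hh j y hy x hx, map_zero]

end CyclicRing

/-! ### Fixed vectors, zero-sum vectors and the splitting of the code. -/

section Labelling

variable {n m c f : ℕ} {σ : Equiv.Perm (Fin n)}

lemma CycleLabelling.apply_eq_of_fixed [NeZero m] {α : Type*} (L : CycleLabelling σ m c f)
    {v : Fin n → α} (hv : ∀ i, v (σ i) = v i) (j : Fin c)
    (k : ZMod m) : v (L.pos (Sum.inl (j, k))) = v (L.pos (Sum.inl (j, 0))) := by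
  have h : ∀ s : ℕ, v (L.pos (Sum.inl (j, (s : ZMod m)))) = v (L.pos (Sum.inl (j, 0))) := by
    intro s
    induction s with
    | zero => simp
    | succ s ih => rw [Nat.cast_succ, ← L.apply_cycle, hv, ih]
  simpa using h k.val

end Labelling

section Decomposition

variable {F : Type*} [Field F] {n m c f : ℕ} {σ : Equiv.Perm (Fin n)}
  {C : Submodule F (Fin n → F)}

lemma comp_mem (hC : IsPermAutomorphism σ C) {v : Fin n → F} (hv : v ∈ C) :
    (fun i => v (σ i)) ∈ C := by
  rw [← hC]
  exact ⟨v, hv, rfl⟩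

lemma comp_pow_mem (hC : IsPermAutomorphism σ C) {v : Fin n → F} (hv : v ∈ C) (s : ℕ) :
    (fun i => v ((σ ^ s) i)) ∈ C := by
  induction s with
  | zero => simpa using hv
  | succ s ih => simpa only [pow_succ, Equiv.Perm.mul_apply] using comp_mem hC ih

lemma comp_symm_mem (hC : IsPermAutomorphism σ C) {v : Fin n → F} (hv : v ∈ C) :
    (fun i => v (σ.symm i)) ∈ C := by
  rw [← hC] at hv
  obtain ⟨w, hw, rfl⟩ := hv
  simpa [LinearMap.funLeft_apply] using hw

lemma isEuclSelfOrthogonal_iff {ι : Type*} [Fintype ι] (D : Submodule F (ι → F)) :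
    IsEuclSelfOrthogonal D ↔ ∀ u ∈ D, ∀ v ∈ D, ∑ i, u i * v i = 0 := Iff.rfl

variable (L : CycleLabelling σ m c f)

lemma CycleLabelling.sum_eq [NeZero m] (g : Fin n → F) : ∑ i, g i =
    ∑ j, ∑ k, g (L.pos (Sum.inl (j, k))) + ∑ j, g (L.pos (Sum.inr j)) := by
  rw [← L.pos.sum_comp, Fintype.sum_sum_type, Fintype.sum_prod_type]

lemma CycleLabelling.pow_apply_cycle (s : ℕ) (j : Fin c) (k : ZMod m) :
    (σ ^ s) (L.pos (Sum.inl (j, k))) = L.pos (Sum.inl (j, k + s)) := by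
  induction s with
  | zero => simp
  | succ s ih => rw [pow_succ', Equiv.Perm.mul_apply, ih, L.apply_cycle, Nat.cast_succ, add_assoc]

lemma CycleLabelling.pow_apply_fixed (s : ℕ) (j : Fin f) :
    (σ ^ s) (L.pos (Sum.inr j)) = L.pos (Sum.inr j) := by
  induction s with
  | zero => simp
  | succ s ih => rw [pow_succ', Equiv.Perm.mul_apply, ih, L.apply_fixed]

lemma sum_fixed_mul_zeroSum [NeZero m] {u v : Fin n → F} (hu : u ∈ fixedSubcode σ C)
    (hv : v ∈ zeroSumSubcode L C) : ∑ i, u i * v i = 0 := by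
  rw [L.sum_eq]
  have h1 : ∀ j, ∑ k, u (L.pos (Sum.inl (j, k))) * v (L.pos (Sum.inl (j, k))) = 0 := by
    intro j
    simp only [L.apply_eq_of_fixed hu.2 j]
    rw [← Finset.mul_sum, hv.2.1, mul_zero]
  simp [h1, hv.2.2]

lemma exists_fixed_add_zeroSum [NeZero m] (hm : (m : F) ≠ 0) (hC : IsPermAutomorphism σ C)
    {v : Fin n → F} (hv : v ∈ C) :
    ∃ a ∈ fixedSubcode σ C, ∃ b ∈ zeroSumSubcode L C, v = a + b := by
  -- The mean of the shifts of `v`: on a long cycle it is the mean of `v` there, and at a fixed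
  -- point it is `v` itself, so `v - a` has zero sum on every cycle.
  set a : Fin n → F := (m : F)⁻¹ • ∑ s : ZMod m, fun i => v ((σ ^ s.val) i) with ha
  have haC : a ∈ C := C.smul_mem _ (C.sum_mem fun s _ => comp_pow_mem hC hv _)
  have hcyc : ∀ j k, a (L.pos (Sum.inl (j, k))) =
      (m : F)⁻¹ * ∑ s : ZMod m, v (L.pos (Sum.inl (j, s))) := by
    intro j k
    simp only [ha, Pi.smul_apply, Finset.sum_apply, smul_eq_mul, L.pow_apply_cycle,
      ZMod.natCast_val, ZMod.cast_id', id]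
    congr 1
    exact Equiv.sum_comp (Equiv.addLeft k) fun s => v (L.pos (Sum.inl (j, s)))
  have hfix : ∀ j, a (L.pos (Sum.inr j)) = v (L.pos (Sum.inr j)) := by
    intro j
    simp [ha, L.pow_apply_fixed, ZMod.card, hm]
  refine ⟨a, ⟨haC, fun i => ?_⟩, v - a, ⟨C.sub_mem hv haC, fun j => ?_, fun j => ?_⟩, by simp⟩
  · obtain ⟨(⟨j, k⟩ | j), rfl⟩ := L.pos.surjective i
    · rw [L.apply_cycle, hcyc, hcyc]
    · rw [L.apply_fixed]
  · simp [Finset.sum_sub_distrib, hcyc, ZMod.card, hm]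
  · simp [hfix]

lemma isEuclSelfOrthogonal_iff_fixed_and_zeroSum [NeZero m] (hm : (m : F) ≠ 0)
    (hC : IsPermAutomorphism σ C) : IsEuclSelfOrthogonal C ↔
      IsEuclSelfOrthogonal (fixedSubcode σ C) ∧ IsEuclSelfOrthogonal (zeroSumSubcode L C) := by
  simp only [isEuclSelfOrthogonal_iff]
  constructor
  · intro h
    exact ⟨fun u hu v hv => h u hu.1 v hv.1, fun u hu v hv => h u hu.1 v hv.1⟩
  · rintro ⟨hF, hE⟩ u hu v hv
    obtain ⟨a, ha, b, hb, rfl⟩ := exists_fixed_add_zeroSum L hm hC hu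
    obtain ⟨a', ha', b', hb', rfl⟩ := exists_fixed_add_zeroSum L hm hC hv
    have h1 := hF a ha a' ha'
    have h2 := hE b hb b' hb'
    have h3 := sum_fixed_mul_zeroSum L ha hb'
    have h4 := sum_fixed_mul_zeroSum L ha' hb
    calc ∑ i, (a + b) i * (a' + b') i
        = ∑ i, a i * a' i + ∑ i, a i * b' i + ∑ i, a' i * b i + ∑ i, b i * b' i := by
          simp only [← Finset.sum_add_distrib, Pi.add_apply]
          exact Finset.sum_congr rfl fun i _ => by ring
      _ = 0 := by rw [h1, h2, h3, h4]; simp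

lemma isEuclSelfOrthogonal_projCode_iff [NeZero m] {p : ℕ} [CharP F p] (hm : (m : F) ≠ 0)
    (h : m ≡ 1 [MOD p] ∨ f = 0) :
    IsEuclSelfOrthogonal (projCode L C) ↔ IsEuclSelfOrthogonal (fixedSubcode σ C) := by
  have key : ∀ u ∈ fixedSubcode σ C, ∀ v ∈ fixedSubcode σ C,
      ∑ i, u i * v i = m * ∑ i, cycleProj L u i * cycleProj L v i := by
    intro u hu v hv
    rw [L.sum_eq, Fintype.sum_sum_type, mul_add]
    congr 1
    · simp only [L.apply_eq_of_fixed hu.2, L.apply_eq_of_fixed hv.2]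
      simp [cycleProj, LinearMap.funLeft_apply, ZMod.card, Finset.mul_sum]
    -- Fixed points count once on the left but `m` times on the right; the two agree if `m = 1` in
    -- `F` or if there are none.
    · rcases h with h | rfl
      · have h1 : (m : F) = 1 := by
          simpa using (CharP.natCast_eq_natCast F p).2 h
        simp [h1, cycleProj, LinearMap.funLeft_apply]
      · simp
  simp only [isEuclSelfOrthogonal_iff]
  constructor
  · intro H u hu v hv
    rw [key u hu v hv, H _ ⟨u, hu, rfl⟩ _ ⟨v, hv, rfl⟩, mul_zero]
  · rintro H _ ⟨u, hu, rfl⟩ _ ⟨v, hv, rfl⟩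
    have h1 := key u hu v hv
    rw [H u hu v hv] at h1
    exact (mul_eq_zero.1 h1.symm).resolve_left hm

end Decomposition

/-! ### The zero-sum subcode as a Hermitian code over `R_m`. -/

section ZeroSum

variable {F : Type*} [Field F] {n m c f : ℕ} [NeZero m] {σ : Equiv.Perm (Fin n)}
  {C : Submodule F (Fin n → F)} (L : CycleLabelling σ m c f)

/-- The vector over `R_m` that belongs to the non-fixed coordinates of `v`. -/
def cyclicVec (v : Fin n → F) (j : Fin c) : CyclicRing F m :=
  ∑ k : ZMod m, v (L.pos (Sum.inl (j, k))) • rootPow k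

lemma mem_phiCode {w : Fin c → CyclicRing F m} :
    w ∈ phiCode L C ↔ ∃ v ∈ zeroSumSubcode L C, cyclicVec L v = w := by
  have h : ∀ v : Fin n → F,
      phi c (LinearMap.funLeft F F (fun jk => L.pos (Sum.inl jk)) v) = cyclicVec L v := by
    intro v
    ext j
    simp [phi, cyclicVec, rootPow, LinearMap.funLeft_apply]
  simp [phiCode, zeroSumStar, h]

lemma comp_pow_mem_zeroSumSubcode (hC : IsPermAutomorphism σ C) {v : Fin n → F}
    (hv : v ∈ zeroSumSubcode L C) (s : ℕ) :
    (fun i => v ((σ ^ s) i)) ∈ zeroSumSubcode L C := by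
  refine ⟨comp_pow_mem hC hv.1 s, fun j => ?_, fun j => ?_⟩
  · simp only [L.pow_apply_cycle]
    rw [← hv.2.1 j]
    exact Equiv.sum_comp (Equiv.addRight (s : ZMod m)) fun k => v (L.pos (Sum.inl (j, k)))
  · simp only [L.pow_apply_fixed]
    exact hv.2.2 j

lemma root_mul_mem_phiCode (hC : IsPermAutomorphism σ C) (u : Fin c → CyclicRing F m)
    (hu : u ∈ phiCode L C) :
    (fun i => AdjoinRoot.root (X ^ m - 1 : F[X]) * u i) ∈ phiCode L C := by
  rw [mem_phiCode] at hu ⊢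
  obtain ⟨v, hv, rfl⟩ := hu
  have hcyc : ∀ j k, σ.symm (L.pos (Sum.inl (j, k))) = L.pos (Sum.inl (j, k - 1)) := fun j k => by
    rw [Equiv.symm_apply_eq, L.apply_cycle, sub_add_cancel]
  have hfix : ∀ j, σ.symm (L.pos (Sum.inr j)) = L.pos (Sum.inr j) := fun j => by
    rw [Equiv.symm_apply_eq, L.apply_fixed]
  -- Multiplication by `x` moves the coefficient at `k` to `k + 1`, so it corresponds to composition
  -- with the inverse of `σ`.
  refine ⟨fun i => v (σ.symm i), ⟨comp_symm_mem hC hv.1, fun j => ?_, fun j => ?_⟩, ?_⟩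
  · simp only [hcyc]
    rw [← hv.2.1 j]
    exact Equiv.sum_comp (Equiv.subRight (1 : ZMod m)) fun k => v (L.pos (Sum.inl (j, k)))
  · simp only [hfix]
    exact hv.2.2 j
  · ext j
    simp only [cyclicVec, hcyc]
    rw [← Equiv.sum_comp (Equiv.addRight (1 : ZMod m)), Finset.mul_sum]
    refine Finset.sum_congr rfl fun k _ => ?_
    simp only [Equiv.coe_addRight, add_sub_cancel_right]
    rw [rootPow_add, rootPow_one, mul_smul_comm, mul_comm]

lemma augmentation_cyclicVec {v : Fin n → F} (hv : v ∈ zeroSumSubcode L C) (j : Fin c) :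
    augmentation (cyclicVec L v j) = 0 := by
  have h : ∀ k : ZMod m, augmentation (rootPow (F := F) k) = 1 := fun k => by
    rw [rootPow, map_pow, ← AdjoinRoot.mk_X, augmentation_mk, eval_X, one_pow]
  simp only [cyclicVec, map_sum, map_smul, h, smul_eq_mul, mul_one]
  exact hv.2.1 j

/-- The coefficients of the Hermitian form are the inner products with the cyclic shifts. -/
lemma hermForm_cyclicVec {u v : Fin n → F} (hu : u ∈ zeroSumSubcode L C) :
    hermForm (cyclicVec L u) (cyclicVec L v) =
      ∑ s : ZMod m, (∑ i, u ((σ ^ s.val) i) * v i) • rootPow s := by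
  have h1 : ∀ s : ZMod m, ∑ i, u ((σ ^ s.val) i) * v i =
      ∑ j, ∑ k, u (L.pos (Sum.inl (j, k + s))) * v (L.pos (Sum.inl (j, k))) := by
    intro s
    rw [L.sum_eq]
    simp [L.pow_apply_cycle, L.pow_apply_fixed, hu.2.2]
  simp only [h1, Finset.sum_smul, hermForm, cyclicVec, map_sum, map_smul, conj_rootPow]
  rw [Finset.sum_comm]
  refine Finset.sum_congr rfl fun j _ => ?_
  rw [Finset.sum_comm, Finset.mul_sum]
  refine Finset.sum_congr rfl fun k _ => ?_
  -- With the index of `u` written as `k + s`, the exponent becomes `(k + s) - k = s`.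
  rw [Finset.sum_mul, ← Equiv.sum_comp (Equiv.addLeft k)]
  refine Finset.sum_congr rfl fun s _ => ?_
  simp only [Equiv.coe_addLeft]
  rw [smul_mul_smul_comm, ← rootPow_add]
  congr 2
  ring

/-- Invariance under `σ` makes every coefficient of the form an inner product of two codewords;
conversely, the coefficient at `s = 0` is the inner product itself. -/
lemma isEuclSelfOrthogonal_zeroSum_iff (hC : IsPermAutomorphism σ C) :
    IsEuclSelfOrthogonal (zeroSumSubcode L C) ↔
      ∀ u ∈ phiCode L C, ∀ v ∈ phiCode L C, hermForm u v = 0 := by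
  rw [isEuclSelfOrthogonal_iff]
  constructor
  · intro h u hu v hv
    obtain ⟨u, hu', rfl⟩ := (mem_phiCode L).1 hu
    obtain ⟨v, hv', rfl⟩ := (mem_phiCode L).1 hv
    rw [hermForm_cyclicVec L hu']
    exact Finset.sum_eq_zero fun s _ => by
      rw [h _ (comp_pow_mem_zeroSumSubcode L hC hu' _) v hv', zero_smul]
  · intro h u hu v hv
    have h0 := h _ ((mem_phiCode L).2 ⟨u, hu, rfl⟩) _ ((mem_phiCode L).2 ⟨v, hv, rfl⟩)
    rw [hermForm_cyclicVec L hu] at h0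
    simpa using eq_zero_of_sum_smul_rootPow _ h0 0

lemma isEuclSelfOrthogonal_zeroSum_iff_constituentsOrthogonal (hm : (m : F) ≠ 0)
    (hC : IsPermAutomorphism σ C) {r t : ℕ} (Φ : ReciprocalFactorization F m r t) :
    IsEuclSelfOrthogonal (zeroSumSubcode L C) ↔ ConstituentsOrthogonal L C Φ := by
  rw [isEuclSelfOrthogonal_zeroSum_iff L hC]
  refine hermForm_eq_zero_iff (X_pow_sub_one_separable_iff.2 hm).squarefree Φ
    (root_mul_mem_phiCode L hC) ?_
  intro u hu i
  obtain ⟨v, hv, rfl⟩ := (mem_phiCode L).1 hu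
  exact augmentation_cyclicVec L hv i

end ZeroSum

end AQC

end

theorem mainTheorem8 {F : Type*} [Field F] [Fintype F] (p : ℕ) [CharP F p]
    {n m c f r t : ℕ} [NeZero m] (hm : Nat.Coprime m (Fintype.card F))
    (σ : Equiv.Perm (Fin n)) (L : AQC.CycleLabelling σ m c f)
    (Φ : AQC.ReciprocalFactorization F m r t)
    (C : Submodule F (Fin n → F)) (hC : AQC.IsPermAutomorphism σ C) :
    (AQC.IsEuclSelfOrthogonal C ↔
      AQC.IsEuclSelfOrthogonal (AQC.fixedSubcode σ C) ∧ AQC.ConstituentsOrthogonal L C Φ) ∧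
    ((m ≡ 1 [MOD p] ∨ f = 0) →
      (AQC.IsEuclSelfOrthogonal C ↔
        AQC.IsEuclSelfOrthogonal (AQC.projCode L C) ∧ AQC.ConstituentsOrthogonal L C Φ)) := by
  have hm' : (m : F) ≠ 0 := by
    -- The order of `F` is zero in `F`, so coprimality to it there means being a unit.
    have h : IsCoprime (m : F) (Fintype.card F : F) := hm.cast
    rw [FiniteField.cast_card_eq_zero, isCoprime_zero_right] at h
    exact h.ne_zero
  have key := AQC.isEuclSelfOrthogonal_iff_fixed_and_zeroSum L hm' hC
  rw [AQC.isEuclSelfOrthogonal_zeroSum_iff_constituentsOrthogonal L hm' hC Φ] at key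
  exact ⟨key, fun h => by rw [AQC.isEuclSelfOrthogonal_projCode_iff (p := p) L hm' h]; exact key⟩
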